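/- Let $q$ be a prime power, let $n\ge 2$ with $(n,q)\neq(2,2)$, and let $V$ be a vector space of dimension $n+1$ over $\mathbb F_q$. Let $\Gamma=(\mathcal P,\mathcal L)$ be the point-hyperplane geometry of $\mathrm{PG}(V)$. Its points are the pairs $(p,H)$ where $p$ is a point and $H$ a hyperplane of $\mathrm{PG}(V)$ with $p\in H$. Its lines are the sets $\ell_{r,H}=\{(p,H): p\in r\}$, for a line $r$ of $\mathrm{PG}(V)$ contained in a hyperplane $H$, and the sets $\ell_{p,S}=\{(p,H): S\subseteq H\}$, for a subspace $S$ of $\mathrm{PG}(V)$ of codimension $2$ and a point $p\in S$. Let $W$ be a vector space over a field $K$ and let $\varepsilon\colon\Gamma\to\mathrm{PG}(W)$ be any projective embedding, that is, an injective map from $\mathcal P$ to the set of points of $\mathrm{PG}(W)$ whose image spans $\mathrm{PG}(W)$ and which maps every line of $\Gamma$ onto a line of $\mathrm{PG}(W)$. For each point $\omega$ of $\Omega=\varepsilon(\mathcal P)$ choose a non-zero vector $v_\omega\in W$ representing it, and let $$\mathcal C(\varepsilon(\Gamma))=\{(\varphi(v_\omega))_{\omega\in\Omega} : \varphi\in W^*\}\subseteq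 K^{\Omega}$$ be the linear code of the projective system $\Omega$ (the row space of a matrix whose columns are the coordinate vectors of the $v_\omega$). Then, for every choice of the $v_\omega$, the code $\mathcal C(\varepsilon(\Gamma))$ is minimal: if $c,c'\in\mathcal C(\varepsilon(\Gamma))$ and $\mathrm{supp}(c')\subseteq\mathrm{supp}(c)$, then $c'=\lambda c$ for some $\lambda\in K$. -/

import Mathlib

open scoped LinearAlgebra.Projectivization

/-- A point-line geometry with point set `P`: the lines are sets of points, every line has at
least two points, and two distinct points are on at most one common line. -/
structure PointLineGeometry (P : Type*) where
  lines : Set (Set P)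
  nonempty : Nonempty P
  two_le : ∀ l ∈ lines, l.Nontrivial
  unique_line : ∀ l ∈ lines, ∀ m ∈ lines, ∀ x y : P,
    x ≠ y → x ∈ l → y ∈ l → x ∈ m → y ∈ m → l = m

/-- The set of points of `PG(W)` contained in the linear subspace `L` of `W`. -/
def projPoints {K W : Type*} [Field K] [AddCommGroup W] [Module K W] (L : Submodule K W) :
    Set (ℙ K W) :=
  {x | x.submodule ≤ L}

/-- A projective embedding of `Γ` in `PG(W)`: an injective map from the points of `Γ` to the
points of `PG(W)` whose image spans `PG(W)` and which maps each line of `Γ` onto a projective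
line. -/
structure ProjectiveEmbedding {P : Type*} (Γ : PointLineGeometry P) (K W : Type*) [Field K]
    [AddCommGroup W] [Module K W] where
  toFun : P → ℙ K W
  injective : Function.Injective toFun
  spans : ⨆ p, (toFun p).submodule = ⊤
  map_line : ∀ l ∈ Γ.lines, ∃ L : Submodule K W,
    Module.finrank K L = 2 ∧ toFun '' l = projPoints L

/-- `v` chooses for every point of `Ω` a non-zero vector representing it. -/
def IsRepresentativeSystem {K W : Type*} [Field K] [AddCommGroup W] [Module K W]
    (Ω : Set (ℙ K W)) (v : Ω → W) : Prop :=
  ∀ ω : Ω, ∃ h : v ω ≠ 0, Projectivization.mk K (v ω) h = ω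

/-- The linear code of the projective system `Ω`, with coordinate positions indexed by `Ω`, and
with respect to the representative vectors `v`. Its words are the evaluations of the linear forms
of `W` at the representatives, so it is the row space of the matrix that has the coordinate
vectors of the representatives as columns. -/
def projectiveCode {K W : Type*} [Field K] [AddCommGroup W] [Module K W]
    (Ω : Set (ℙ K W)) (v : Ω → W) : Submodule K (Ω → K) :=
  LinearMap.range (LinearMap.pi fun ω : Ω => Module.Dual.eval K W (v ω))

/-- The codeword `c` of `C` is minimal: each word of `C` whose support lies in that of `c` is a
scalar multiple of `c`. -/
def IsMinimalCodeword {ι K : Type*} [Field K] (C : Submodule K (ι → K)) (c : ι → K) : Prop :=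
  ∀ c' ∈ C, Function.support c' ⊆ Function.support c → ∃ a : K, c' = a • c

/-- A code is minimal if all its codewords are minimal. -/
def IsMinimalCode {ι K : Type*} [Field K] (C : Submodule K (ι → K)) : Prop :=
  ∀ c ∈ C, IsMinimalCodeword C c

/-- The incident point-hyperplane pairs of `PG(V)`. -/
@[ext]
structure PointHyperplanePair (F V : Type*) [Field F] [AddCommGroup V] [Module F V] where
  point : ℙ F V
  hyperplane : Submodule F V
  codim : Module.finrank F (V ⧸ hyperplane) = 1
  incident : point.submodule ≤ hyperplane

namespace PointHyperplane

variable {F V : Type*} [Field F] [AddCommGroup V] [Module F V]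

/-- All pairs `(p, H)` with `p` on the line `r` of `PG(V)`; here `r` is contained in `H`. -/
def lineOfLine (r H : Submodule F V) : Set (PointHyperplanePair F V) :=
  {x | x.point.submodule ≤ r ∧ x.hyperplane = H}

/-- All pairs `(p, H)` with `H` containing `S`; here `S` has codimension two and contains `p`. -/
def lineOfCodimTwo (p : ℙ F V) (S : Submodule F V) : Set (PointHyperplanePair F V) :=
  {x | x.point = p ∧ S ≤ x.hyperplane}

/-- The lines of the point-hyperplane geometry of `PG(V)`. -/
def lines (F V : Type*) [Field F] [AddCommGroup V] [Module F V] :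
    Set (Set (PointHyperplanePair F V)) :=
  {l | ∃ r H : Submodule F V, Module.finrank F r = 2 ∧ Module.finrank F (V ⧸ H) = 1 ∧
      r ≤ H ∧ l = lineOfLine r H} ∪
  {l | ∃ (p : ℙ F V) (S : Submodule F V), Module.finrank F (V ⧸ S) = 2 ∧
      p.submodule ≤ S ∧ l = lineOfCodimTwo p S}

theorem exists_two_points {r : Submodule F V} (hr : Module.finrank F r = 2) :
    ∃ p q : ℙ F V, p ≠ q ∧ p.submodule ≤ r ∧ q.submodule ≤ r := by
  have : Module.Finite F r := Module.finite_of_finrank_eq_succ hr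
  let b := Module.finBasisOfFinrankEq F r hr
  have h0 : ((b 0 : r) : V) ≠ 0 := by simpa using b.ne_zero 0
  have h1 : ((b 1 : r) : V) ≠ 0 := by simpa using b.ne_zero 1
  refine ⟨.mk F _ h0, .mk F _ h1, ?_, ?_, ?_⟩
  · intro h
    rw [Projectivization.mk_eq_mk_iff'] at h
    obtain ⟨a, ha⟩ := h
    have h2 : a • b 1 = b 0 := Subtype.ext ha
    have h3 := congrArg (fun z => b.repr z 0) h2
    simp at h3
  · simp [Projectivization.submodule_mk]
  · simp [Projectivization.submodule_mk]

theorem eq_of_two_points {r : Submodule F V} (hr : Module.finrank F r = 2) {p q : ℙ F V}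
    (hpq : p ≠ q) (hp : p.submodule ≤ r) (hq : q.submodule ≤ r) :
    r = p.submodule ⊔ q.submodule := by
  have : Module.Finite F r := Module.finite_of_finrank_eq_succ hr
  symm
  apply Submodule.eq_of_le_of_finrank_le (sup_le hp hq)
  rw [hr]
  by_contra! hlt
  have e1 : p.submodule = p.submodule ⊔ q.submodule := by
    have : Module.Finite F ↥(p.submodule ⊔ q.submodule) :=
      Submodule.finiteDimensional_of_le (sup_le hp hq)
    apply Submodule.eq_of_le_of_finrank_le le_sup_left
    rw [Projectivization.finrank_submodule]
    omega
  have e2 : q.submodule = p.submodule ⊔ q.submodule := by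
    have : Module.Finite F ↥(p.submodule ⊔ q.submodule) :=
      Submodule.finiteDimensional_of_le (sup_le hp hq)
    apply Submodule.eq_of_le_of_finrank_le le_sup_right
    rw [Projectivization.finrank_submodule]
    omega
  exact hpq (Projectivization.submodule_injective (e1.trans e2.symm))

/-- The codimension of a larger subspace, computed in the quotient by the smaller one. -/
theorem finrank_map_mkQ {S H : Submodule F V} [Module.Finite F (V ⧸ S)] (h : S ≤ H) :
    Module.finrank F (V ⧸ H) + Module.finrank F (H.map S.mkQ) = Module.finrank F (V ⧸ S) := by
  rw [← (Submodule.quotientQuotientEquivQuotient S H h).finrank_eq]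
  exact Submodule.finrank_quotient_add_finrank _

theorem exists_two_hyperplanes {S : Submodule F V} (hS : Module.finrank F (V ⧸ S) = 2) :
    ∃ H H' : Submodule F V, H ≠ H' ∧ Module.finrank F (V ⧸ H) = 1 ∧
      Module.finrank F (V ⧸ H') = 1 ∧ S ≤ H ∧ S ≤ H' := by
  have : Module.Finite F (V ⧸ S) := Module.finite_of_finrank_eq_succ hS
  have hT : Module.finrank F (⊤ : Submodule F (V ⧸ S)) = 2 := by simpa using hS
  obtain ⟨p, q, hpq, -, -⟩ := exists_two_points hT
  have key (p : ℙ F (V ⧸ S)) :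
      Module.finrank F (V ⧸ p.submodule.comap S.mkQ) = 1 ∧ S ≤ p.submodule.comap S.mkQ := by
    have hle : S ≤ p.submodule.comap S.mkQ := by
      intro x hx
      simp [(Submodule.Quotient.mk_eq_zero S).2 hx]
    have h := finrank_map_mkQ hle
    rw [Submodule.map_comap_eq_of_surjective S.mkQ_surjective,
      Projectivization.finrank_submodule] at h
    exact ⟨by omega, hle⟩
  refine ⟨_, _, fun h => hpq ?_, (key p).1, (key q).1, (key p).2, (key q).2⟩
  exact Projectivization.submodule_injective
    (Submodule.comap_injective_of_surjective S.mkQ_surjective h)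

theorem eq_of_two_hyperplanes {S : Submodule F V} (hS : Module.finrank F (V ⧸ S) = 2)
    {H H' : Submodule F V} (hne : H ≠ H') (hH : Module.finrank F (V ⧸ H) = 1)
    (hH' : Module.finrank F (V ⧸ H') = 1) (h : S ≤ H) (h' : S ≤ H') : S = H ⊓ H' := by
  have : Module.Finite F (V ⧸ S) := Module.finite_of_finrank_eq_succ hS
  have d1 := finrank_map_mkQ h
  have d2 := finrank_map_mkQ h'
  have d := finrank_map_mkQ (le_inf h h')
  have back {A : Submodule F V} (hA : S ≤ A) : (A.map S.mkQ).comap S.mkQ = A := by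
    rw [Submodule.comap_map_eq, Submodule.ker_mkQ, sup_eq_left.2 hA]
  have hle1 : (H ⊓ H').map S.mkQ ≤ H.map S.mkQ := Submodule.map_mono inf_le_left
  have hle2 : (H ⊓ H').map S.mkQ ≤ H'.map S.mkQ := Submodule.map_mono inf_le_right
  have hz : Module.finrank F ((H ⊓ H').map S.mkQ) = 0 := by
    by_contra hpos
    have e1 := Submodule.eq_of_le_of_finrank_le hle1 (by omega)
    have e2 := Submodule.eq_of_le_of_finrank_le hle2 (by omega)
    apply hne
    rw [← back h, ← back h', ← e1, ← e2]
  have hb := Submodule.finrank_eq_zero.1 hz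
  have hc := back (le_inf h h')
  rw [hb] at hc
  simpa using hc

theorem lines_nontrivial : ∀ l ∈ lines F V, l.Nontrivial := by
  rintro l (⟨r, H, hr, hH, hle, rfl⟩ | ⟨p, S, hS, hp, rfl⟩)
  · obtain ⟨p, q, hpq, hp, hq⟩ := exists_two_points hr
    exact ⟨⟨p, H, hH, hp.trans hle⟩, ⟨hp, rfl⟩, ⟨q, H, hH, hq.trans hle⟩, ⟨hq, rfl⟩,
      fun h => hpq (congrArg PointHyperplanePair.point h)⟩
  · obtain ⟨H, H', hne, hH, hH', h, h'⟩ := exists_two_hyperplanes hS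
    exact ⟨⟨p, H, hH, hp.trans h⟩, ⟨rfl, h⟩, ⟨p, H', hH', hp.trans h'⟩, ⟨rfl, h'⟩,
      fun e => hne (congrArg PointHyperplanePair.hyperplane e)⟩

theorem lines_unique : ∀ l ∈ lines F V, ∀ m ∈ lines F V, ∀ x y : PointHyperplanePair F V,
    x ≠ y → x ∈ l → y ∈ l → x ∈ m → y ∈ m → l = m := by
  rintro l (⟨r, H, hr, hH, hle, rfl⟩ | ⟨p, S, hS, hp, rfl⟩)
    m (⟨r', H', hr', hH', hle', rfl⟩ | ⟨p', S', hS', hp', rfl⟩) x y hxy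
    ⟨hx1, hx2⟩ ⟨hy1, hy2⟩ ⟨hx3, hx4⟩ ⟨hy3, hy4⟩
  · have hne : x.point ≠ y.point := fun h => hxy (PointHyperplanePair.ext h (hx2.trans hy2.symm))
    rw [eq_of_two_points hr hne hx1 hy1, eq_of_two_points hr' hne hx3 hy3, ← hx2, ← hx4]
  · exact absurd (PointHyperplanePair.ext (hx3.trans hy3.symm) (hx2.trans hy2.symm)) hxy
  · exact absurd (PointHyperplanePair.ext (hx1.trans hy1.symm) (hx4.trans hy4.symm)) hxy
  · have hne : x.hyperplane ≠ y.hyperplane :=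
      fun h => hxy (PointHyperplanePair.ext (hx1.trans hy1.symm) h)
    rw [eq_of_two_hyperplanes hS hne x.codim y.codim hx2 hy2,
      eq_of_two_hyperplanes hS' hne x.codim y.codim hx4 hy4, ← hx1, ← hx3]

theorem nonempty_pair (h : 2 ≤ Module.finrank F V) : Nonempty (PointHyperplanePair F V) := by
  have : Module.Finite F V := Module.finite_of_finrank_pos (by omega)
  let b := Module.finBasis F V
  let i : Fin (Module.finrank F V) := ⟨0, by omega⟩
  let j : Fin (Module.finrank F V) := ⟨1, by omega⟩
  have hij : j ≠ i := by simp [i, j, Fin.ext_iff]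
  refine ⟨⟨.mk F (b j) (b.ne_zero j), LinearMap.ker (b.coord i), ?_, ?_⟩⟩
  · have hs : Function.Surjective (b.coord i) := by
      intro a
      exact ⟨a • b i, by simp⟩
    rw [((b.coord i).quotKerEquivOfSurjective hs).finrank_eq, Module.finrank_self]
  · rw [Projectivization.submodule_mk, Submodule.span_singleton_le_iff_mem]
    simp [hij]

end PointHyperplane

/-- The point-hyperplane geometry of `PG(V)`, where `PG(V)` has projective dimension at least one
(so that there are incident point-hyperplane pairs). -/
def pointHyperplaneGeometry (F V : Type*) [Field F] [AddCommGroup V] [Module F V]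
    (h : 2 ≤ Module.finrank F V) : PointLineGeometry (PointHyperplanePair F V) where
  lines := PointHyperplane.lines F V
  nonempty := PointHyperplane.nonempty_pair h
  two_le := PointHyperplane.lines_nontrivial
  unique_line := PointHyperplane.lines_unique

/-!
If the support of the word of `ψ` lies in that of `φ`, then `φ` and `ψ` vanish together at a point
of each line of `Γ` through a point off the zeros of `φ`, since the zeros of a form are a geometric
hyperplane. So the quotient `ψ / φ` is constant along such lines, and the code is minimal as soon
as the collinearity graph stays connected when a geometric hyperplane `X` is removed.

To join pairs with hyperplanes `ker ξ` and `ker η` off `X`, let `S` be their intersection. A point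
of `S` which gives pairs off `X` with both hyperplanes joins them. Unless there is such a point,
all points of `S` give pairs in `X` with one of the hyperplanes, say `ker ξ`, and then every point
of `ker ξ` outside `S` gives a pair off `X` with `ker ξ`. Some such point can be joined through a
third hyperplane to a point of `ker η`, by a count based on `S` having more than two vectors.
-/

section LinearAlgebra

variable {F V : Type*} [Field F] [AddCommGroup V] [Module F V]

theorem add_mem_of_linearIndependent {s : Set V} (hsmul : ∀ (c : F), ∀ x ∈ s, c • x ∈ s)
    (hadd : ∀ x ∈ s, ∀ y ∈ s, LinearIndependent F ![x, y] → x + y ∈ s) {x y : V} (hx : x ∈ s)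
    (hy : y ∈ s) : x + y ∈ s := by
  by_cases hind : LinearIndependent F ![x, y]
  · exact hadd x hx y hy hind
  obtain rfl | hx0 := eq_or_ne x 0
  · simpa using hy
  rw [LinearIndependent.pair_iff' hx0] at hind
  push Not at hind
  obtain ⟨a, rfl⟩ := hind
  simpa only [add_smul, one_smul] using hsmul (1 + a) x hx

theorem finrank_span_pair {x y : V} (h : LinearIndependent F ![x, y]) :
    Module.finrank F (Submodule.span F {x, y}) = 2 := by
  have hspan := finrank_span_eq_card h
  rwa [Matrix.range_cons_cons_empty, Fintype.card_fin] at hspan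

theorem finrank_quotient_dualCoannihilator (Φ : Submodule F (Module.Dual F V))
    [FiniteDimensional F Φ] :
    Module.finrank F (V ⧸ Φ.dualCoannihilator) = Module.finrank F Φ := by
  have : FiniteDimensional F (V ⧸ Φ.dualCoannihilator) :=
    Subspace.finiteDimensional_quot_dualCoannihilator_iff.2 ‹_›
  rw [(LinearEquiv.ofBijective _
      (Subspace.flip_quotDualCoannihilatorToDual_bijective Φ)).finrank_eq,
    Subspace.dual_finrank_eq]

theorem finrank_quotient_ker {ξ : Module.Dual F V} (hξ : ξ ≠ 0) :
    Module.finrank F (V ⧸ LinearMap.ker ξ) = 1 := by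
  rw [(ξ.quotKerEquivOfSurjective (LinearMap.surjective hξ)).finrank_eq, Module.finrank_self]

theorem exists_eq_ker_of_finrank_quotient {H : Submodule F V}
    (hH : Module.finrank F (V ⧸ H) = 1) : ∃ ξ : Module.Dual F V, H = LinearMap.ker ξ := by
  have : Module.Finite F (V ⧸ H) := Module.finite_of_finrank_eq_succ hH
  let e : (V ⧸ H) ≃ₗ[F] F := LinearEquiv.ofFinrankEq _ _ (by rw [hH, Module.finrank_self])
  exact ⟨e.toLinearMap ∘ₗ H.mkQ, by rw [LinearEquiv.ker_comp, Submodule.ker_mkQ]⟩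

theorem finrank_inf_ker_add_one {L : Submodule F V} [FiniteDimensional F L]
    {φ : Module.Dual F V} (h : ¬ L ≤ LinearMap.ker φ) :
    Module.finrank F (L ⊓ LinearMap.ker φ : Submodule F V) + 1 = Module.finrank F L := by
  have hne : φ.domRestrict L ≠ 0 := fun h0 => h fun w hw => LinearMap.congr_fun h0 ⟨w, hw⟩
  rw [← Module.Dual.finrank_ker_add_one_of_ne_zero hne, LinearMap.ker_domRestrict,
    ← Submodule.map_comap_subtype,
    (Submodule.equivMapOfInjective _ L.injective_subtype _).finrank_eq]

theorem exists_mem_notMem_notMem {S A B : Submodule F V} (hA : ¬ S ≤ A) (hB : ¬ S ≤ B) :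
    ∃ x ∈ S, x ∉ A ∧ x ∉ B := by
  have h : ¬ (S : Set V) ⊆ A ∪ B := by
    rw [AddSubgroupClass.subset_union]
    exact not_or.2 ⟨hA, hB⟩
  simpa [Set.not_subset] using h

theorem nontrivial_sdiff_of_not_le {S A : Submodule F V} (hS : 2 < (S : Set V).encard)
    (hA : ¬ S ≤ A) : ((S : Set V) \ A).Nontrivial := by
  obtain ⟨a, ha, haA⟩ := SetLike.not_le_iff_exists.1 hA
  obtain ⟨b, hb, hne⟩ : ∃ b ∈ (S : Set V), b ∉ ({0, a} : Set V) := by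
    by_contra! h
    exact (Set.encard_le_encard h).not_gt ((Set.encard_insert_le _ _).trans_lt (by
      simpa [one_add_one_eq_two] using hS))
  simp only [Set.mem_insert_iff, Set.mem_singleton_iff, not_or] at hne
  by_cases hbA : b ∈ A
  · exact ⟨a, ⟨ha, haA⟩, a + b, ⟨S.add_mem ha hb, fun h => haA ((A.add_mem_iff_left hbA).1 h)⟩,
      by simpa using hne.1⟩
  · exact ⟨a, ⟨ha, haA⟩, b, ⟨hb, hbA⟩, Ne.symm hne.2⟩

theorem exists_eq_smul_of_ker_le {ξ η : Module.Dual F V}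
    (h : LinearMap.ker ξ ≤ LinearMap.ker η) : ∃ c : F, η = c • ξ := by
  have hspan := mem_span_of_iInf_ker_le_ker (L := fun _ : Unit => ξ) (K := η) (by simpa using h)
  rw [Set.range_const, Submodule.mem_span_singleton] at hspan
  exact hspan.imp fun _ => Eq.symm

theorem span_pair_inf_span_pair_le {x y y' : V} {ξ η : Module.Dual F V} (hne : y ≠ y')
    (hξx : ξ x = 0) (hηx : η x ≠ 0) (hξy : ξ y = 1) (hξy' : ξ y' = 1) (hηy : η y = 0)
    (hηy' : η y' = 0) :
    Submodule.span F {x, y} ⊓ Submodule.span F {x, y'} ≤ Submodule.span F {x} := by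
  rintro w ⟨hw, hw'⟩
  obtain ⟨a, b, rfl⟩ := Submodule.mem_span_pair.1 hw
  obtain ⟨c, d, h⟩ := Submodule.mem_span_pair.1 hw'
  have hd : d = b := by simpa [hξx, hξy, hξy'] using congrArg ξ h
  have hc : c = a := by simpa [hηx, hηy, hηy'] using congrArg η h
  have hb : b = 0 := by
    rw [hd, hc, add_right_inj] at h
    by_contra hb
    exact hne (smul_right_injective V hb h).symm
  exact Submodule.mem_span_singleton.2 ⟨a, by simp [hb]⟩

theorem two_lt_encard_of_ne_bot {S : Submodule F V} (hS : S ≠ ⊥)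
    (h : Module.finrank F S ≠ 1 ∨ Nat.card F ≠ 2) : 2 < (S : Set V).encard := by
  obtain ⟨w, hw, hw0⟩ := S.ne_bot_iff.1 hS
  obtain ⟨u, hu, huw⟩ : ∃ u ∈ S, u ∉ ({0, w} : Set V) := by
    by_contra! hsub
    refine h.elim (fun h => h ?_) fun h => h ((Nat.card_eq_two_iff' 0).2 ⟨1, one_ne_zero, ?_⟩)
    · have hspan : S = Submodule.span F {w} := by
        refine le_antisymm (fun u hu => ?_) ((Submodule.span_singleton_le_iff_mem _ _).2 hw)
        obtain rfl | rfl := hsub u hu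
        exacts [zero_mem _, Submodule.mem_span_singleton_self _]
      rw [hspan, finrank_span_singleton hw0]
    · intro c hc
      obtain h | h := hsub (c • w) (S.smul_mem c hw)
      · exact absurd h (smul_ne_zero hc hw0)
      · exact smul_left_injective F hw0 (h.trans (one_smul F w).symm)
  rw [← Set.encard_pair hw0.symm]
  refine (Set.toFinite _).encard_lt_encard ⟨?_, fun hsub => huw (hsub hu)⟩
  exact Set.insert_subset S.zero_mem (Set.singleton_subset_iff.2 hw)

theorem finrank_le_finrank_inf_ker_add_two [FiniteDimensional F V] (ξ η : Module.Dual F V) :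
    Module.finrank F V ≤
      Module.finrank F (LinearMap.ker ξ ⊓ LinearMap.ker η : Submodule F V) + 2 := by
  have hrange := Submodule.finrank_le (LinearMap.range (ξ.prod η))
  rw [Module.finrank_prod, Module.finrank_self] at hrange
  rw [← LinearMap.ker_prod, ← LinearMap.finrank_range_add_finrank_ker (ξ.prod η)]
  omega

theorem two_lt_encard_inf_ker (hV : 3 ≤ Module.finrank F V)
    (hex : ¬ (Module.finrank F V = 3 ∧ Nat.card F = 2)) (ξ η : Module.Dual F V) :
    2 < ((LinearMap.ker ξ ⊓ LinearMap.ker η : Submodule F V) : Set V).encard := by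
  have : FiniteDimensional F V := Module.finite_of_finrank_pos (by omega)
  have hdim := finrank_le_finrank_inf_ker_add_two ξ η
  refine two_lt_encard_of_ne_bot (fun hbot => ?_) (by omega)
  rw [hbot, finrank_bot] at hdim
  omega

end LinearAlgebra

namespace PointLineGeometry

variable {P : Type*} (Γ : PointLineGeometry P)

/-- A geometric hyperplane of `Γ`: a set of points that each line meets in exactly one point or is
contained in. The full point set counts as one, as it is the zero set of the form `0`. -/
def IsGeometricHyperplane (X : Set P) : Prop :=
  ∀ l ∈ Γ.lines, l ⊆ X ∨ ∃ x, l ∩ X = {x}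

/-- The collinearity graph of `Γ`: two distinct points are adjacent if they are on a line. -/
def collinearityGraph : SimpleGraph P where
  Adj x y := x ≠ y ∧ ∃ l ∈ Γ.lines, x ∈ l ∧ y ∈ l
  symm := ⟨fun _ _ ⟨hne, l, hl, hx, hy⟩ => ⟨hne.symm, l, hl, hy, hx⟩⟩
  loopless := ⟨fun _ h => h.1 rfl⟩

variable {Γ} {X l : Set P}

theorem reachable_of_mem_line (hl : l ∈ Γ.lines) {x y : (Xᶜ : Set P)} (hx : (x : P) ∈ l)
    (hy : (y : P) ∈ l) : (Γ.collinearityGraph.induce Xᶜ).Reachable x y := by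
  obtain rfl | hne := eq_or_ne x y
  · exact .refl _
  · exact SimpleGraph.Adj.reachable ⟨Subtype.coe_ne_coe.2 hne, l, hl, hx, hy⟩

namespace IsGeometricHyperplane

theorem line_subset (hX : Γ.IsGeometricHyperplane X) (hl : l ∈ Γ.lines) {x y : P} (hne : x ≠ y)
    (hx : x ∈ l ∩ X) (hy : y ∈ l ∩ X) : l ⊆ X := by
  refine (hX l hl).resolve_right ?_
  rintro ⟨z, hz⟩
  rw [hz, Set.mem_singleton_iff] at hx hy
  exact hne (hx.trans hy.symm)

theorem exists_mem_line (hX : Γ.IsGeometricHyperplane X) (hl : l ∈ Γ.lines) :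
    ∃ x ∈ l, x ∈ X := by
  obtain hsub | ⟨x, hx⟩ := hX l hl
  · obtain ⟨x, hx⟩ := (Γ.two_le l hl).nonempty
    exact ⟨x, hx, hsub hx⟩
  · exact ⟨x, hx.ge rfl⟩

end IsGeometricHyperplane

end PointLineGeometry

section Projectivization

variable {K W : Type*} [Field K] [AddCommGroup W] [Module K W]

theorem eq_of_submodule_le {p q : ℙ K W} (h : p.submodule ≤ q.submodule) : p = q :=
  Projectivization.submodule_injective <| Submodule.eq_of_le_of_finrank_eq h <| by
    rw [p.finrank_submodule, q.finrank_submodule]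

theorem IsRepresentativeSystem.submodule_le_ker_iff {Ω : Set (ℙ K W)} {v : Ω → W}
    (hv : IsRepresentativeSystem Ω v) (ω : Ω) (φ : Module.Dual K W) :
    (ω : ℙ K W).submodule ≤ LinearMap.ker φ ↔ φ (v ω) = 0 := by
  obtain ⟨hne, hmk⟩ := hv ω
  rw [← hmk, Projectivization.submodule_mk, Submodule.span_singleton_le_iff_mem,
    LinearMap.mem_ker]

end Projectivization

namespace ProjectiveEmbedding

variable {P K W : Type*} [Field K] [AddCommGroup W] [Module K W] {Γ : PointLineGeometry P}
  (ε : ProjectiveEmbedding Γ K W)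

/-- The points of `Γ` that are mapped into the hyperplane `φ = 0` of `PG(W)`. -/
def zeros (φ : Module.Dual K W) : Set P :=
  {x | (ε.toFun x).submodule ≤ LinearMap.ker φ}

variable {ε} {φ ψ : Module.Dual K W}

theorem zeros_inter_subset_zeros_sub_smul (c : K) :
    ε.zeros φ ∩ ε.zeros ψ ⊆ ε.zeros (ψ - c • φ) := by
  rintro x ⟨hφ, hψ⟩ w hw
  have hφw : φ w = 0 := hφ hw
  have hψw : ψ w = 0 := hψ hw
  simp [hφw, hψw]

theorem exists_mem_zeros_sub_smul {x : P} (hx : x ∉ ε.zeros φ) :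
    ∃ c : K, x ∈ ε.zeros (ψ - c • φ) := by
  simp only [zeros, Set.mem_ofPred_eq, Projectivization.submodule_eq,
    Submodule.span_singleton_le_iff_mem, LinearMap.mem_ker] at hx ⊢
  exact ⟨ψ (ε.toFun x).rep / φ (ε.toFun x).rep, by simp [hx]⟩

variable (ε φ) in
theorem isGeometricHyperplane_zeros : Γ.IsGeometricHyperplane (ε.zeros φ) := by
  intro l hl
  obtain ⟨L, hL, himage⟩ := ε.map_line l hl
  have hmem {x : P} (hx : x ∈ l) : (ε.toFun x).submodule ≤ L :=
    himage.le (Set.mem_image_of_mem _ hx)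
  by_cases hle : L ≤ LinearMap.ker φ
  · exact .inl fun x hx => (hmem hx).trans hle
  have : FiniteDimensional K L := Module.finite_of_finrank_eq_succ hL
  have hrank : Module.finrank K (L ⊓ LinearMap.ker φ : Submodule K W) = 1 := by
    have := finrank_inf_ker_add_one hle
    omega
  have hq := Projectivization.submodule_mk'' _ hrank
  obtain ⟨x, hx, hxq⟩ := himage.ge (show Projectivization.mk'' _ hrank ∈ projPoints L from
    hq.le.trans inf_le_left)
  rw [← hxq] at hq
  refine .inr ⟨x, Set.eq_singleton_iff_unique_mem.2 ⟨⟨hx, hq.le.trans inf_le_right⟩, ?_⟩⟩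
  rintro y ⟨hy, hyφ⟩
  exact ε.injective (eq_of_submodule_le (hq ▸ le_inf (hmem hy) hyφ))

/-- On a line with a point off the zeros of `φ`, the forms `φ` and `ψ` have a common zero, so there
`ψ - c • φ` vanishes at two points as soon as it vanishes at one point off the zeros of `φ`. -/
theorem mem_zeros_sub_smul_of_adj (hsub : ε.zeros φ ⊆ ε.zeros ψ) {c : K} {x y : P}
    (hadj : Γ.collinearityGraph.Adj x y) (hx : x ∉ ε.zeros φ)
    (hxc : x ∈ ε.zeros (ψ - c • φ)) : y ∈ ε.zeros (ψ - c • φ) := by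
  obtain ⟨-, l, hl, hxl, hyl⟩ := hadj
  obtain ⟨z, hzl, hz⟩ := (ε.isGeometricHyperplane_zeros φ).exists_mem_line hl
  exact (ε.isGeometricHyperplane_zeros (ψ - c • φ)).line_subset hl
    (ne_of_mem_of_not_mem hz hx) ⟨hzl, zeros_inter_subset_zeros_sub_smul c ⟨hz, hsub hz⟩⟩
    ⟨hxl, hxc⟩ hyl

theorem exists_zeros_sub_smul_eq_univ (hsub : ε.zeros φ ⊆ ε.zeros ψ)
    (hconn : (Γ.collinearityGraph.induce (ε.zeros φ)ᶜ).Preconnected) :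
    ∃ c : K, ε.zeros (ψ - c • φ) = Set.univ := by
  by_cases huniv : ε.zeros φ = Set.univ
  · refine ⟨0, Set.univ_subset_iff.1 ?_⟩
    simpa [huniv] using hsub
  obtain ⟨x, hx⟩ := (Set.ne_univ_iff_exists_notMem _).1 huniv
  obtain ⟨c, hc⟩ := exists_mem_zeros_sub_smul (ψ := ψ) hx
  have hoff (y : ((ε.zeros φ)ᶜ : Set P)) : (y : P) ∈ ε.zeros (ψ - c • φ) := by
    have hreach := (SimpleGraph.reachable_iff_reflTransGen _ _).1 (hconn ⟨x, hx⟩ y)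
    induction hreach with
    | refl => exact hc
    | @tail a _ _ hadj ih => exact mem_zeros_sub_smul_of_adj hsub hadj a.2 ih
  refine ⟨c, Set.eq_univ_of_forall fun y => ?_⟩
  by_cases hy : y ∈ ε.zeros φ
  · exact zeros_inter_subset_zeros_sub_smul c ⟨hy, hsub hy⟩
  · exact hoff ⟨y, hy⟩

theorem isMinimalCode {v : Set.range ε.toFun → W}
    (hv : IsRepresentativeSystem (Set.range ε.toFun) v)
    (hconn : ∀ X, Γ.IsGeometricHyperplane X → (Γ.collinearityGraph.induce Xᶜ).Preconnected) :
    IsMinimalCode (projectiveCode (Set.range ε.toFun) v) := by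
  rintro _ ⟨φ, rfl⟩ _ ⟨ψ, rfl⟩ hsupp
  have hsub : ε.zeros φ ⊆ ε.zeros ψ := fun x hφ => by
    let ω : Set.range ε.toFun := ⟨ε.toFun x, x, rfl⟩
    rw [zeros, Set.mem_ofPred_eq] at hφ ⊢
    rw [hv.submodule_le_ker_iff ω] at hφ ⊢
    exact not_imp_not.1 (@hsupp ω) hφ
  obtain ⟨c, hc⟩ :=
    exists_zeros_sub_smul_eq_univ hsub (hconn _ (ε.isGeometricHyperplane_zeros φ))
  refine ⟨c, funext fun ω => ?_⟩
  obtain ⟨x, hx⟩ := ω.2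
  have hle : (ω : ℙ K W).submodule ≤ LinearMap.ker (ψ - c • φ) :=
    hx ▸ hc.ge (Set.mem_univ x)
  exact sub_eq_zero.1 ((hv.submodule_le_ker_iff ω _).1 hle)

end ProjectiveEmbedding

/-- The linear data of a geometric hyperplane of the point-hyperplane geometry: the pairs of a
vector `x` and a form `ξ` with `ξ x = 0` such that the pair `(⟨x⟩, ker ξ)` is in the hyperplane.
For a fixed form these vectors make up the subspace `points ξ`, for a fixed vector these forms
make up the subspace `forms x`, and `points ξ` has codimension at most one in `ker ξ`. -/
structure FlagHyperplane (F V : Type*) [Field F] [AddCommGroup V] [Module F V] where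
  points : Module.Dual F V → Submodule F V
  forms : V → Submodule F (Module.Dual F V)
  mem_points_iff_mem_forms {x : V} {ξ : Module.Dual F V} : x ∈ points ξ ↔ ξ ∈ forms x
  exists_sub_smul_mem {ξ : Module.Dual F V} {x y : V} :
    ξ x = 0 → ξ y = 0 → x ∉ points ξ → ∃ c : F, y - c • x ∈ points ξ

namespace FlagHyperplane

variable {F V : Type*} [Field F] [AddCommGroup V] [Module F V] (X : FlagHyperplane F V)

/-- The pair `(⟨x⟩, ker ξ)` is incident, but not in the hyperplane. -/
def Off (x : V) (ξ : Module.Dual F V) : Prop :=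
  ξ x = 0 ∧ x ∉ X.points ξ

/-- No form that vanishes at `y` gives a pair with first component `⟨x⟩` off the hyperplane. -/
def Blocks (x y : V) : Prop :=
  (Submodule.span F {x, y}).dualAnnihilator ≤ X.forms x

/-- There is a path off the hyperplane from the pairs with hyperplane `ker ξ` to those with
hyperplane `ker η` that changes the hyperplane, the point, and once more the hyperplane. -/
def Linked (ξ η : Module.Dual F V) : Prop :=
  ∃ x ζ y, X.Off x ξ ∧ X.Off x ζ ∧ X.Off y ζ ∧ X.Off y η

variable {X}

theorem Off.right_ne_zero {x : V} {ξ : Module.Dual F V} (h : X.Off x ξ) : ξ ≠ 0 := by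
  rintro rfl
  exact h.2 (X.mem_points_iff_mem_forms.2 (zero_mem _))

theorem Off.smul_right {x : V} {ξ : Module.Dual F V} {c : F} (h : X.Off x ξ) (hc : c ≠ 0) :
    X.Off x (c • ξ) := by
  refine ⟨by simp [h.1], fun hx => h.2 ?_⟩
  rw [X.mem_points_iff_mem_forms] at hx ⊢
  exact ((X.forms x).smul_mem_iff hc).1 hx

theorem Linked.symm {ξ η : Module.Dual F V} : X.Linked ξ η → X.Linked η ξ := by
  rintro ⟨x, ζ, y, hxξ, hxζ, hyζ, hyη⟩
  exact ⟨y, ζ, x, hyη, hyζ, hxζ, hxξ⟩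

theorem exists_off_off_of_not_blocks {x y : V} (hxy : ¬ X.Blocks x y) (hyx : ¬ X.Blocks y x) :
    ∃ ξ, X.Off x ξ ∧ X.Off y ξ := by
  rw [Blocks, Set.pair_comm] at hyx
  obtain ⟨ξ, hξ, hx, hy⟩ := exists_mem_notMem_notMem hxy hyx
  rw [Submodule.mem_dualAnnihilator] at hξ
  rw [← X.mem_points_iff_mem_forms] at hx hy
  exact ⟨ξ, ⟨hξ x (Submodule.mem_span_of_mem (by simp)), hx⟩,
    hξ y (Submodule.mem_span_of_mem (by simp)), hy⟩

/-- The forms vanishing at `x` are sums of forms vanishing at `x, y` and at `x, y'`. -/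
theorem not_off_of_blocks_of_blocks {x y y' : V} (h : X.Blocks x y) (h' : X.Blocks x y')
    (hinf : Submodule.span F {x, y} ⊓ Submodule.span F {x, y'} ≤ Submodule.span F {x})
    (ξ : Module.Dual F V) : ¬ X.Off x ξ := by
  rintro ⟨hξx, hx⟩
  have hξ : ξ ∈ (Submodule.span F {x}).dualAnnihilator := by
    simpa [Submodule.mem_dualAnnihilator, Submodule.mem_span_singleton] using
      fun _ => Or.inr hξx
  have hle := Submodule.dualAnnihilator_anti hinf
  rw [Subspace.dualAnnihilator_inf_eq] at hle
  exact hx (X.mem_points_iff_mem_forms.2 (sup_le h h' (hle hξ)))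

theorem off_of_inf_le {ξ η : Module.Dual F V} {p z : V}
    (hS : LinearMap.ker ξ ⊓ LinearMap.ker η ≤ X.points ξ) (hp : X.Off p ξ) (hzξ : ξ z = 0)
    (hzη : η z ≠ 0) : X.Off z ξ := by
  refine ⟨hzξ, fun hz => hp.2 ?_⟩
  have hmem : p - (η p / η z) • z ∈ X.points ξ := hS (by simp [hp.1, hzξ, hzη])
  simpa using add_mem hmem ((X.points ξ).smul_mem (η p / η z) hz)

theorem nontrivial_setOf_off {ξ η : Module.Dual F V} {p : V}
    (hS : 2 < ((LinearMap.ker ξ ⊓ LinearMap.ker η : Submodule F V) : Set V).encard)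
    (hp : X.Off p η) (hker : ¬ LinearMap.ker η ≤ LinearMap.ker ξ) :
    {y | ξ y = 1 ∧ X.Off y η}.Nontrivial := by
  obtain ⟨y, hyη, hyξ⟩ : ∃ y, η y = 0 ∧ ξ y = 1 := by
    obtain ⟨w, (hwη : η w = 0), (hwξ : ξ w ≠ 0)⟩ := SetLike.not_le_iff_exists.1 hker
    exact ⟨(ξ w)⁻¹ • w, by simp [hwη], by simp [hwξ]⟩
  by_cases hle : LinearMap.ker ξ ⊓ LinearMap.ker η ≤ X.points η
  · have hnt := (Set.one_lt_encard_iff_nontrivial.1 (lt_trans (by norm_num) hS)).image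
      (add_right_injective y)
    refine hnt.mono ?_
    rintro _ ⟨s, ⟨(hsξ : ξ s = 0), (hsη : η s = 0)⟩, rfl⟩
    rw [inf_comm] at hle
    exact ⟨by simp [hyξ, hsξ],
      off_of_inf_le hle hp (by simp [hyη, hsη]) (by simp [hyξ, hsξ])⟩
  · obtain ⟨a, ⟨(haξ : ξ a = 0), (haη : η a = 0)⟩, ha⟩ := SetLike.not_le_iff_exists.1 hle
    obtain ⟨c, hc⟩ := X.exists_sub_smul_mem haη hyη ha
    have hnt := (nontrivial_sdiff_of_not_le hS hle).image (add_right_injective (y - c • a))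
    refine hnt.mono ?_
    rintro _ ⟨s, ⟨⟨(hsξ : ξ s = 0), (hsη : η s = 0)⟩, hs⟩, rfl⟩
    exact ⟨by simp [hyξ, haξ, hsξ], by simp [hyη, haη, hsη],
      fun h => hs (((X.points η).add_mem_iff_right hc).1 h)⟩

theorem linked_of_ker_le {ξ η : Module.Dual F V} {p q : V} (hp : X.Off p ξ) (hq : X.Off q η)
    (hker : LinearMap.ker η ≤ LinearMap.ker ξ) : X.Linked ξ η := by
  obtain ⟨c, rfl⟩ := exists_eq_smul_of_ker_le hker
  have hc : c ≠ 0 := (smul_ne_zero_iff.1 hp.right_ne_zero).1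
  exact ⟨q, η, q, hq.smul_right hc, hq, hq, hq⟩

/-- Of any two points `⟨z⟩` of `ker ξ` and `⟨y⟩` of `ker η` outside the intersection, one blocks
the other unless they link `ξ` to `η`. With two choices of `y` and more than two of `z`, some point
would block two others, and then no pair on that point would be off the hyperplane. -/
theorem linked_of_inf_le {ξ η : Module.Dual F V} {p q : V}
    (hS : 2 < ((LinearMap.ker ξ ⊓ LinearMap.ker η : Submodule F V) : Set V).encard)
    (hp : X.Off p ξ) (hq : X.Off q η) (hle : LinearMap.ker ξ ⊓ LinearMap.ker η ≤ X.points ξ) :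
    X.Linked ξ η := by
  by_cases hker : LinearMap.ker η ≤ LinearMap.ker ξ
  · exact linked_of_ker_le hp hq hker
  obtain ⟨y₁, ⟨hy₁, hoff₁⟩, y₂, ⟨hy₂, hoff₂⟩, hne⟩ := nontrivial_setOf_off hS hq hker
  have hpη : η p ≠ 0 := fun h => hp.2 (hle ⟨hp.1, h⟩)
  by_contra hlink
  have blocks_or_blocks {z y : V} (hz : X.Off z ξ) (hy : X.Off y η) :
      X.Blocks z y ∨ X.Blocks y z := by
    by_contra! h
    obtain ⟨ζ, hzζ, hyζ⟩ := exists_off_off_of_not_blocks h.1 h.2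
    exact hlink ⟨z, ζ, y, hz, hzζ, hyζ, hy⟩
  let Z : Set V := {z | ξ z = 0 ∧ η z = 1}
  have exists_blocks : ∀ z ∈ Z, ∃ y ∈ ({y₁, y₂} : Set V), X.Blocks y z := by
    rintro z ⟨hzξ, hzη⟩
    have hz : X.Off z ξ := off_of_inf_le hle hp hzξ (by simp [hzη])
    by_contra! h
    exact not_off_of_blocks_of_blocks
      ((blocks_or_blocks hz hoff₁).resolve_right (h y₁ (by simp)))
      ((blocks_or_blocks hz hoff₂).resolve_right (h y₂ (by simp)))
      (span_pair_inf_span_pair_le hne hzξ (by simp [hzη]) hy₁ hy₂ hoff₁.1 hoff₂.1) ξ hz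
  choose! f hfmem hf using exists_blocks
  have hcard : ({y₁, y₂} : Set V).encard < Z.encard := by
    rw [Set.encard_pair hne]
    refine hS.trans_le ?_
    rw [← (add_right_injective ((η p)⁻¹ • p)).encard_image]
    refine Set.encard_le_encard ?_
    rintro _ ⟨s, ⟨(hsξ : ξ s = 0), (hsη : η s = 0)⟩, rfl⟩
    exact ⟨by simp [hp.1, hsξ], by simp [hpη, hsη]⟩
  obtain ⟨z, hz, z', hz', hzz', hff⟩ := Set.exists_ne_map_eq_of_encard_lt_of_maps_to hcard hfmem
  have hy : ξ (f z) = 1 ∧ X.Off (f z) η := by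
    obtain h | h := hfmem z hz
    exacts [h ▸ ⟨hy₁, hoff₁⟩, h ▸ ⟨hy₂, hoff₂⟩]
  exact not_off_of_blocks_of_blocks (hf z hz) (hff ▸ hf z' hz')
    (span_pair_inf_span_pair_le hzz' hy.2.1 (by simp [hy.1]) hz.2 hz'.2 hz.1 hz'.1) η hy.2

theorem linked {ξ η : Module.Dual F V} {p q : V}
    (hS : 2 < ((LinearMap.ker ξ ⊓ LinearMap.ker η : Submodule F V) : Set V).encard)
    (hp : X.Off p ξ) (hq : X.Off q η) : X.Linked ξ η := by
  by_cases hξ : LinearMap.ker ξ ⊓ LinearMap.ker η ≤ X.points ξ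
  · exact linked_of_inf_le hS hp hq hξ
  by_cases hη : LinearMap.ker ξ ⊓ LinearMap.ker η ≤ X.points η
  · rw [inf_comm] at hS hη
    exact (linked_of_inf_le hS hq hp hη).symm
  obtain ⟨z, ⟨hzξ, hzη⟩, hξz, hηz⟩ := exists_mem_notMem_notMem hξ hη
  exact ⟨z, ξ, z, ⟨hzξ, hξz⟩, ⟨hzξ, hξz⟩, ⟨hzξ, hξz⟩, hzη, hηz⟩

end FlagHyperplane

namespace PointHyperplanePair

variable {F V : Type*} [Field F] [AddCommGroup V] [Module F V] {f g : PointHyperplanePair F V}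
  {x y : V} {ξ η : Module.Dual F V}

/-- The vector `x` and the form `ξ` are homogeneous coordinates of the pair `f = (⟨x⟩, ker ξ)`; in
particular `x` and `ξ` are non-zero. -/
def Represents (f : PointHyperplanePair F V) (x : V) (ξ : Module.Dual F V) : Prop :=
  f.point.submodule = Submodule.span F {x} ∧ f.hyperplane = LinearMap.ker ξ

theorem exists_represents (f : PointHyperplanePair F V) : ∃ x ξ, f.Represents x ξ := by
  obtain ⟨ξ, hξ⟩ := exists_eq_ker_of_finrank_quotient f.codim
  exact ⟨f.point.rep, ξ, f.point.submodule_eq, hξ⟩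

theorem exists_represents_of_apply_eq_zero (hx : x ≠ 0) (hξ : ξ ≠ 0) (h : ξ x = 0) :
    ∃ f : PointHyperplanePair F V, f.Represents x ξ :=
  ⟨⟨.mk F x hx, LinearMap.ker ξ, finrank_quotient_ker hξ, by
    simpa [Projectivization.submodule_mk] using h⟩, Projectivization.submodule_mk x hx, rfl⟩

namespace Represents

theorem left_ne_zero (h : f.Represents x ξ) : x ≠ 0 := by
  rintro rfl
  have hrank := f.point.finrank_submodule
  rw [h.1, Submodule.span_zero_singleton, finrank_bot] at hrank
  exact zero_ne_one hrank

theorem right_ne_zero (h : f.Represents x ξ) : ξ ≠ 0 := by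
  rintro rfl
  have hcodim := f.codim
  rw [h.2, LinearMap.ker_zero, Module.finrank_zero_of_subsingleton] at hcodim
  exact zero_ne_one hcodim

theorem apply_eq_zero (h : f.Represents x ξ) : ξ x = 0 := by
  have hx : x ∈ f.point.submodule := h.1 ▸ Submodule.mem_span_singleton_self x
  exact h.2.le (f.incident hx)

theorem eq (hf : f.Represents x ξ) (hg : g.Represents x ξ) : f = g :=
  PointHyperplanePair.ext (Projectivization.submodule_injective (hf.1.trans hg.1.symm))
    (hf.2.trans hg.2.symm)

theorem of_smul_left {c : F} (h : f.Represents (c • x) ξ) : f.Represents x ξ := by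
  have hc : c ≠ 0 := (smul_ne_zero_iff.1 h.left_ne_zero).1
  exact ⟨h.1.trans (Submodule.span_singleton_smul_eq hc.isUnit x), h.2⟩

theorem of_smul_right {c : F} (h : f.Represents x (c • ξ)) : f.Represents x ξ := by
  have hc : c ≠ 0 := (smul_ne_zero_iff.1 h.right_ne_zero).1
  exact ⟨h.1, h.2.trans (LinearMap.ker_smul ξ c hc)⟩

theorem linearIndependent_left_iff (hf : f.Represents x ξ) (hg : g.Represents y ξ) :
    LinearIndependent F ![x, y] ↔ f ≠ g := by
  rw [LinearIndependent.pair_iff' hf.left_ne_zero, Ne, ← not_exists, not_iff_not]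
  constructor
  · rintro ⟨a, rfl⟩
    exact hf.eq hg.of_smul_left
  · rintro rfl
    exact Submodule.mem_span_singleton.1
      ((hf.1.symm.trans hg.1).ge (Submodule.mem_span_singleton_self y))

theorem linearIndependent_right_iff (hf : f.Represents x ξ) (hg : g.Represents x η) :
    LinearIndependent F ![ξ, η] ↔ f ≠ g := by
  rw [LinearIndependent.pair_iff' hf.right_ne_zero, Ne, ← not_exists, not_iff_not]
  constructor
  · rintro ⟨a, rfl⟩
    exact hf.eq hg.of_smul_right
  · rintro rfl
    exact (exists_eq_smul_of_ker_le (hf.2.symm.trans hg.2).le).imp fun _ => Eq.symm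

end Represents

end PointHyperplanePair

namespace PointHyperplane

open PointHyperplanePair

variable {F V : Type*} [Field F] [AddCommGroup V] [Module F V] {f g : PointHyperplanePair F V}
  {x y : V} {ξ η : Module.Dual F V}

theorem lineOfLine_span_pair_mem_lines (hind : LinearIndependent F ![x, y]) (hξ : ξ ≠ 0)
    (hx : ξ x = 0) (hy : ξ y = 0) :
    lineOfLine (Submodule.span F {x, y}) (LinearMap.ker ξ) ∈ lines F V := by
  refine .inl ⟨_, _, finrank_span_pair hind, finrank_quotient_ker hξ, ?_, rfl⟩
  rw [Submodule.span_le, Set.pair_subset_iff]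
  exact ⟨hx, hy⟩

theorem mem_lineOfLine_iff {r : Submodule F V} :
    f ∈ lineOfLine r (LinearMap.ker ξ) ↔ ∃ x ∈ r, f.Represents x ξ := by
  constructor
  · rintro ⟨hr, hξ⟩
    refine ⟨f.point.rep, hr ?_, f.point.submodule_eq, hξ⟩
    exact f.point.submodule_eq ▸ Submodule.mem_span_singleton_self _
  · rintro ⟨x, hx, hf⟩
    exact ⟨hf.1.le.trans ((Submodule.span_singleton_le_iff_mem _ _).2 hx), hf.2⟩

theorem lineOfCodimTwo_dualCoannihilator_mem_lines (hind : LinearIndependent F ![ξ, η])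
    (hf : f.Represents x ξ) (hη : η x = 0) :
    lineOfCodimTwo f.point (Submodule.span F {ξ, η}).dualCoannihilator ∈ lines F V := by
  refine .inr ⟨_, _, ?_, ?_, rfl⟩
  · have : FiniteDimensional F (Submodule.span F {ξ, η}) := .span_of_finite F (Set.toFinite _)
    rw [finrank_quotient_dualCoannihilator, finrank_span_pair hind]
  · rw [hf.1, Submodule.span_singleton_le_iff_mem, ← SetLike.mem_coe,
      Submodule.coe_dualCoannihilator_span]
    simp [hf.apply_eq_zero, hη]

theorem mem_lineOfCodimTwo_dualCoannihilator {Φ : Submodule F (Module.Dual F V)}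
    (hf : f.Represents x ξ) (hg : g.Represents x η) (hη : η ∈ Φ) :
    g ∈ lineOfCodimTwo f.point Φ.dualCoannihilator := by
  refine ⟨Projectivization.submodule_injective (hg.1.trans hf.1.symm), fun z hz => ?_⟩
  rw [hg.2]
  exact (Submodule.mem_dualCoannihilator z).1 hz η hη

theorem exists_line_of_hyperplane_eq (hne : f ≠ g) (h : f.hyperplane = g.hyperplane) :
    ∃ l ∈ lines F V, f ∈ l ∧ g ∈ l := by
  obtain ⟨x, ξ, hf⟩ := f.exists_represents
  obtain ⟨y, -, hy, -⟩ := g.exists_represents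
  have hg : g.Represents y ξ := ⟨hy, h ▸ hf.2⟩
  exact ⟨_, lineOfLine_span_pair_mem_lines ((hf.linearIndependent_left_iff hg).2 hne)
    hf.right_ne_zero hf.apply_eq_zero hg.apply_eq_zero,
    mem_lineOfLine_iff.2 ⟨x, Submodule.mem_span_of_mem (by simp), hf⟩,
    mem_lineOfLine_iff.2 ⟨y, Submodule.mem_span_of_mem (by simp), hg⟩⟩

theorem exists_line_of_point_eq (hne : f ≠ g) (h : f.point = g.point) :
    ∃ l ∈ lines F V, f ∈ l ∧ g ∈ l := by
  obtain ⟨x, ξ, hf⟩ := f.exists_represents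
  obtain ⟨-, η, -, hη⟩ := g.exists_represents
  have hg : g.Represents x η := ⟨h ▸ hf.1, hη⟩
  exact ⟨_, lineOfCodimTwo_dualCoannihilator_mem_lines
    ((hf.linearIndependent_right_iff hg).2 hne) hf hg.apply_eq_zero,
    mem_lineOfCodimTwo_dualCoannihilator hf hf (Submodule.mem_span_of_mem (by simp)),
    mem_lineOfCodimTwo_dualCoannihilator hf hg (Submodule.mem_span_of_mem (by simp))⟩

end PointHyperplane

/-- The pair `(⟨x⟩, ker ξ)` is incident and belongs to `X`; the relation is also satisfied if
`x` or `ξ` is zero. -/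
def FlagMem {F V : Type*} [Field F] [AddCommGroup V] [Module F V]
    (X : Set (PointHyperplanePair F V)) (x : V) (ξ : Module.Dual F V) : Prop :=
  ξ x = 0 ∧ ∀ f : PointHyperplanePair F V, f.Represents x ξ → f ∈ X

section FlagMem

variable {F V : Type*} [Field F] [AddCommGroup V] [Module F V]
  {X : Set (PointHyperplanePair F V)} {f : PointHyperplanePair F V} {x : V} {ξ : Module.Dual F V}

theorem flagMem_zero_left (X : Set (PointHyperplanePair F V)) (ξ : Module.Dual F V) :
    FlagMem X 0 ξ :=
  ⟨map_zero ξ, fun _ hf => absurd rfl hf.left_ne_zero⟩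

theorem flagMem_zero_right (X : Set (PointHyperplanePair F V)) (x : V) :
    FlagMem X x (0 : Module.Dual F V) :=
  ⟨rfl, fun _ hf => absurd rfl hf.right_ne_zero⟩

theorem FlagMem.smul_left (h : FlagMem X x ξ) (c : F) : FlagMem X (c • x) ξ :=
  ⟨by simp [h.1], fun f hf => h.2 f hf.of_smul_left⟩

theorem FlagMem.smul_right (h : FlagMem X x ξ) (c : F) : FlagMem X x (c • ξ) :=
  ⟨by simp [h.1], fun f hf => h.2 f hf.of_smul_right⟩

theorem PointHyperplanePair.Represents.flagMem_iff (hf : f.Represents x ξ) :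
    FlagMem X x ξ ↔ f ∈ X :=
  ⟨fun h => h.2 f hf, fun h => ⟨hf.apply_eq_zero, fun _ hg => hg.eq hf ▸ h⟩⟩

theorem exists_represents_notMem (hξx : ξ x = 0) (h : ¬ FlagMem X x ξ) :
    ∃ f ∉ X, f.Represents x ξ := by
  simp only [FlagMem, hξx, true_and] at h
  push Not at h
  exact h.imp fun _ => And.symm

end FlagMem

namespace PointLineGeometry.IsGeometricHyperplane

open PointHyperplanePair PointHyperplane

variable {F V : Type*} [Field F] [AddCommGroup V] [Module F V] {hV : 2 ≤ Module.finrank F V}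
  {X : Set (PointHyperplanePair F V)} {x y : V} {ξ η : Module.Dual F V}

theorem flagMem_add_left (hX : (pointHyperplaneGeometry F V hV).IsGeometricHyperplane X)
    (hind : LinearIndependent F ![x, y]) (hx : FlagMem X x ξ) (hy : FlagMem X y ξ) :
    FlagMem X (x + y) ξ := by
  refine ⟨by simp [hx.1, hy.1], fun f hf => ?_⟩
  have hξ := hf.right_ne_zero
  obtain ⟨a, ha⟩ := exists_represents_of_apply_eq_zero (hind.ne_zero 0) hξ hx.1
  obtain ⟨b, hb⟩ := exists_represents_of_apply_eq_zero (hind.ne_zero 1) hξ hy.1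
  have mem_line {c : PointHyperplanePair F V} {z : V} (hz : z ∈ Submodule.span F {x, y})
      (hc : c.Represents z ξ) : c ∈ lineOfLine (Submodule.span F {x, y}) (LinearMap.ker ξ) :=
    mem_lineOfLine_iff.2 ⟨z, hz, hc⟩
  have hxs : x ∈ Submodule.span F {x, y} := Submodule.mem_span_of_mem (by simp)
  have hys : y ∈ Submodule.span F {x, y} := Submodule.mem_span_of_mem (by simp)
  exact hX.line_subset (lineOfLine_span_pair_mem_lines hind hξ hx.1 hy.1)
    ((ha.linearIndependent_left_iff hb).1 hind) ⟨mem_line hxs ha, hx.2 a ha⟩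
    ⟨mem_line hys hb, hy.2 b hb⟩ (mem_line (add_mem hxs hys) hf)

theorem flagMem_add_right (hX : (pointHyperplaneGeometry F V hV).IsGeometricHyperplane X)
    (hind : LinearIndependent F ![ξ, η]) (hξ : FlagMem X x ξ) (hη : FlagMem X x η) :
    FlagMem X x (ξ + η) := by
  refine ⟨by simp [hξ.1, hη.1], fun f hf => ?_⟩
  have hx := hf.left_ne_zero
  obtain ⟨a, ha⟩ := exists_represents_of_apply_eq_zero hx (hind.ne_zero 0) hξ.1
  obtain ⟨b, hb⟩ := exists_represents_of_apply_eq_zero hx (hind.ne_zero 1) hη.1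
  have hξs : ξ ∈ Submodule.span F {ξ, η} := Submodule.mem_span_of_mem (by simp)
  have hηs : η ∈ Submodule.span F {ξ, η} := Submodule.mem_span_of_mem (by simp)
  exact hX.line_subset (lineOfCodimTwo_dualCoannihilator_mem_lines hind ha hη.1)
    ((ha.linearIndependent_right_iff hb).1 hind)
    ⟨mem_lineOfCodimTwo_dualCoannihilator ha ha hξs, hξ.2 a ha⟩
    ⟨mem_lineOfCodimTwo_dualCoannihilator ha hb hηs, hη.2 b hb⟩
    (mem_lineOfCodimTwo_dualCoannihilator ha hf (add_mem hξs hηs))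

theorem exists_flagMem_sub_smul
    (hX : (pointHyperplaneGeometry F V hV).IsGeometricHyperplane X) (hx : ξ x = 0)
    (hy : ξ y = 0) (hoff : ¬ FlagMem X x ξ) : ∃ c : F, FlagMem X (y - c • x) ξ := by
  obtain ⟨f, hfX, hf⟩ := exists_represents_notMem hx hoff
  by_cases hind : LinearIndependent F ![x, y]
  · obtain ⟨g, hgl, hgX⟩ := hX.exists_mem_line
      (lineOfLine_span_pair_mem_lines hind hf.right_ne_zero hx hy)
    obtain ⟨z, hz, hg⟩ := mem_lineOfLine_iff.1 hgl
    obtain ⟨a, b, rfl⟩ := Submodule.mem_span_pair.1 hz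
    have hmem : FlagMem X (a • x + b • y) ξ := hg.flagMem_iff.2 hgX
    have hb : b ≠ 0 := by
      rintro rfl
      rw [zero_smul, add_zero] at hg
      exact hfX (hf.eq hg.of_smul_left ▸ hgX)
    refine ⟨-(b⁻¹ * a), ?_⟩
    convert hmem.smul_left b⁻¹ using 1
    rw [smul_add, smul_smul, inv_smul_smul₀ hb]
    module
  · rw [LinearIndependent.pair_iff' hf.left_ne_zero] at hind
    push Not at hind
    obtain ⟨c, rfl⟩ := hind
    exact ⟨c, by simpa using flagMem_zero_left X ξ⟩

/-- The relation `FlagMem X` of a geometric hyperplane `X`, in terms of its subspaces. -/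
def flagHyperplane (hX : (pointHyperplaneGeometry F V hV).IsGeometricHyperplane X) :
    FlagHyperplane F V where
  points ξ :=
    { carrier := {x | FlagMem X x ξ}
      zero_mem' := flagMem_zero_left X ξ
      add_mem' := add_mem_of_linearIndependent (s := {x | FlagMem X x ξ})
        (fun c _ hx => FlagMem.smul_left hx c) fun _ hx _ hy hind => hX.flagMem_add_left hind hx hy
      smul_mem' c _ hx := FlagMem.smul_left hx c }
  forms x :=
    { carrier := {ξ | FlagMem X x ξ}
      zero_mem' := flagMem_zero_right X x
      add_mem' := add_mem_of_linearIndependent (s := {ξ | FlagMem X x ξ})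
        (fun c _ hξ => by exact FlagMem.smul_right hξ c)
        fun _ hξ _ hη hind => hX.flagMem_add_right hind hξ hη
      smul_mem' c _ hξ := FlagMem.smul_right hξ c }
  mem_points_iff_mem_forms := Iff.rfl
  exists_sub_smul_mem := hX.exists_flagMem_sub_smul

theorem off_flagHyperplane_iff
    (hX : (pointHyperplaneGeometry F V hV).IsGeometricHyperplane X) :
    hX.flagHyperplane.Off x ξ ↔ ∃ f ∉ X, f.Represents x ξ := by
  constructor
  · rintro ⟨hx, hoff⟩
    exact exists_represents_notMem hx hoff
  · rintro ⟨f, hfX, hf⟩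
    exact ⟨hf.apply_eq_zero, fun h => hfX (hf.flagMem_iff.1 h)⟩

end PointLineGeometry.IsGeometricHyperplane

namespace PointHyperplane

variable {F V : Type*} [Field F] [AddCommGroup V] [Module F V] {hV : 2 ≤ Module.finrank F V}
  {X : Set (PointHyperplanePair F V)}

theorem reachable_of_hyperplane_eq {f g : (Xᶜ : Set (PointHyperplanePair F V))}
    (h : (f : PointHyperplanePair F V).hyperplane = (g : PointHyperplanePair F V).hyperplane) :
    ((pointHyperplaneGeometry F V hV).collinearityGraph.induce Xᶜ).Reachable f g := by
  obtain rfl | hne := eq_or_ne f g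
  · exact .refl _
  obtain ⟨l, hl, hf, hg⟩ := exists_line_of_hyperplane_eq (Subtype.coe_ne_coe.2 hne) h
  exact PointLineGeometry.reachable_of_mem_line hl hf hg

theorem reachable_of_point_eq {f g : (Xᶜ : Set (PointHyperplanePair F V))}
    (h : (f : PointHyperplanePair F V).point = (g : PointHyperplanePair F V).point) :
    ((pointHyperplaneGeometry F V hV).collinearityGraph.induce Xᶜ).Reachable f g := by
  obtain rfl | hne := eq_or_ne f g
  · exact .refl _
  obtain ⟨l, hl, hf, hg⟩ := exists_line_of_point_eq (Subtype.coe_ne_coe.2 hne) h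
  exact PointLineGeometry.reachable_of_mem_line hl hf hg

theorem preconnected_induce_compl (hV3 : 3 ≤ Module.finrank F V)
    (hex : ¬ (Module.finrank F V = 3 ∧ Nat.card F = 2))
    (hX : (pointHyperplaneGeometry F V hV).IsGeometricHyperplane X) :
    ((pointHyperplaneGeometry F V hV).collinearityGraph.induce Xᶜ).Preconnected := by
  rintro ⟨f, hf⟩ ⟨g, hg⟩
  obtain ⟨p, ξ, hpξ⟩ := f.exists_represents
  obtain ⟨q, η, hqη⟩ := g.exists_represents
  obtain ⟨x, ζ, y, hxξ, hxζ, hyζ, hyη⟩ :=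
    FlagHyperplane.linked (two_lt_encard_inf_ker hV3 hex ξ η)
      (hX.off_flagHyperplane_iff.2 ⟨f, hf, hpξ⟩) (hX.off_flagHyperplane_iff.2 ⟨g, hg, hqη⟩)
  rw [hX.off_flagHyperplane_iff] at hxξ hxζ hyζ hyη
  obtain ⟨a, ha, haξ⟩ := hxξ
  obtain ⟨b, hb, hbζ⟩ := hxζ
  obtain ⟨c, hc, hcζ⟩ := hyζ
  obtain ⟨d, hd, hdη⟩ := hyη
  have hfa := reachable_of_hyperplane_eq (hV := hV) (f := ⟨f, hf⟩) (g := ⟨a, ha⟩)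
    (hpξ.2.trans haξ.2.symm)
  have hab := reachable_of_point_eq (hV := hV) (f := ⟨a, ha⟩) (g := ⟨b, hb⟩)
    (Projectivization.submodule_injective (haξ.1.trans hbζ.1.symm))
  have hbc := reachable_of_hyperplane_eq (hV := hV) (f := ⟨b, hb⟩) (g := ⟨c, hc⟩)
    (hbζ.2.trans hcζ.2.symm)
  have hcd := reachable_of_point_eq (hV := hV) (f := ⟨c, hc⟩) (g := ⟨d, hd⟩)
    (Projectivization.submodule_injective (hcζ.1.trans hdη.1.symm))
  have hdg := reachable_of_hyperplane_eq (hV := hV) (f := ⟨d, hd⟩) (g := ⟨g, hg⟩)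
    (hdη.2.trans hqη.2.symm)
  exact hfa.trans (hab.trans (hbc.trans (hcd.trans hdg)))

end PointHyperplane

theorem proposition4p9_general {F V K W : Type*} [Field F] [AddCommGroup V] [Module F V]
    [Field K] [AddCommGroup W] [Module K W] (hV : 3 ≤ Module.finrank F V)
    (hex : ¬ (Module.finrank F V = 3 ∧ Nat.card F = 2))
    (ε : ProjectiveEmbedding (pointHyperplaneGeometry F V (Nat.le_of_succ_le hV)) K W)
    (v : Set.range ε.toFun → W) (hv : IsRepresentativeSystem (Set.range ε.toFun) v) :
    IsMinimalCode (projectiveCode (Set.range ε.toFun) v) :=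
  ProjectiveEmbedding.isMinimalCode hv fun _ => PointHyperplane.preconnected_induce_compl hV hex

theorem proposition4p9 {F V K W : Type*} [Field F] [Finite F] [AddCommGroup V] [Module F V]
    [Field K] [AddCommGroup W] [Module K W]
    (n : ℕ) (hn : 2 ≤ n) (hV : Module.finrank F V = n + 1)
    (hex : ¬ (n = 2 ∧ Nat.card F = 2))
    (ε : ProjectiveEmbedding (pointHyperplaneGeometry F V (by omega)) K W)
    (v : Set.range ε.toFun → W) (hv : IsRepresentativeSystem (Set.range ε.toFun) v) :
    IsMinimalCode (projectiveCode (Set.range ε.toFun) v) :=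
  proposition4p9_general (by omega) (by omega) ε v hv
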